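/- All rings are commutative with identity. A ring is quasi-local if it has exactly one maximal ideal (it need not be Noetherian), and coherent if each of its finitely generated ideals is finitely presented. For an $R$-module $M$ put $M^*=\operatorname{Hom}_R(M,R)$. A finitely generated $R$-module $G$ belongs to the G-class of $R$ if $\operatorname{Ext}^i_R(G,R)=0$ and $\operatorname{Ext}^i_R(G^*,R)=0$ for all $i>0$ and the natural map $G\to G^{**}$ is an isomorphism. A G-resolution of $M$ is an exact sequence $\cdots\to G_1\to G_0\to M\to 0$ with every $G_i$ in the G-class of $R$; its length is $\sup\{i\mid G_i\ne 0\}$ (and $0$ if all $G_i$ are zero). The G-dimension of $M$ is the infimum of the lengths of all G-resolutions of $M$; it is finite if and only if $M$ has a G-resolution of finite length. A quasi-local ring $R$ is called Gorenstein if every finitely generated ideal of $R$ has finite G-dimension as an $R$-module. **Theorem.** Let $R$ be a quasi-local coherent ring with maximal ideal $\mathfrak m$ and let $x\in\mathfrak m$ be a non-zero-divisor on $R$. Then $R$ is Gorenstein if and only if $R/(x)$ is Gorenstein. -/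

import Mathlib

universe u

/-- A commutative ring is coherent if every finitely generated ideal is finitely presented. -/
class IsCoherentRing (R : Type u) [CommRing R] : Prop where
  finitePresentation_of_fg : ∀ I : Ideal R, I.FG → Module.FinitePresentation R I

/-- `Ext^i_R(M, R) = 0` for all `i > 0`. -/
def ExtVanishes (R : Type u) [CommRing R] (M : Type u) [AddCommGroup M] [Module R M] : Prop :=
  ∀ i : ℕ, 0 < i →
    Subsingleton (CategoryTheory.Abelian.Ext (ModuleCat.of R M) (ModuleCat.of R R) i)

/-- Membership in the G-class of `R`: `M` is finitely generated, `Ext^i_R(M, R)` and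
`Ext^i_R(M^*, R)` vanish for `i > 0`, and the natural map `M → M^{**}` is an isomorphism. -/
structure IsGClass (R : Type u) [CommRing R] (M : Type u) [AddCommGroup M] [Module R M] :
    Prop where
  finite : Module.Finite R M
  extVanishes : ExtVanishes R M
  extVanishes_dual : ExtVanishes R (Module.Dual R M)
  bijective_eval : Function.Bijective (Module.Dual.eval R M)

/-- A G-resolution `⋯ → G₂ → G₁ → G₀ → M → 0` of `M`: an exact sequence in which every `Gᵢ`
belongs to the G-class of `R`. -/
structure GResolution (R : Type u) [CommRing R] (M : Type u) [AddCommGroup M] [Module R M] where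
  /-- the modules of the resolution -/
  G : ℕ → ModuleCat.{u} R
  /-- the differentials -/
  d : ∀ i : ℕ, G (i + 1) →ₗ[R] G i
  /-- the augmentation -/
  aug : G 0 →ₗ[R] M
  isGClass : ∀ i : ℕ, IsGClass R (G i)
  exact_d : ∀ i : ℕ, Function.Exact (d (i + 1)) (d i)
  exact_aug : Function.Exact (d 0) aug
  surjective_aug : Function.Surjective aug

/-- The length of a G-resolution: the supremum of all `i` with `Gᵢ ≠ 0`
(zero for the zero complex). -/
noncomputable def GResolution.length {R : Type u} [CommRing R] {M : Type u} [AddCommGroup M]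
    [Module R M] (P : GResolution R M) : ℕ∞ :=
  ⨆ i : {i : ℕ // Nontrivial (P.G i)}, ((i : ℕ) : ℕ∞)

/-- The G-dimension of `M`: the infimum of the lengths of all G-resolutions of `M`. A module
without any G-resolution gets the value `⊤`, so it is not of finite G-dimension either. -/
noncomputable def gDim (R : Type u) [CommRing R] (M : Type u) [AddCommGroup M] [Module R M] :
    ℕ∞ :=
  ⨅ P : GResolution R M, P.length

/-- A quasi-local ring (not necessarily Noetherian, with a unique maximal ideal) is Gorenstein
if every finitely generated ideal has finite G-dimension. -/
structure IsGorensteinQuasiLocal (R : Type u) [CommRing R] : Prop where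
  isLocalRing : IsLocalRing R
  gDim_lt_top : ∀ I : Ideal R, I.FG → gDim R I < ⊤

/-! Write S = R/(x). Both directions pass between an R-module and an S-module along syzygies and end
in one criterion, `isGClass_of_syzygy_of_dual`: a class of modules closed under duals and under
kernels of suitable free covers, with functionals on those kernels extending, lies in the G-class.
Extension of functionals gives Ext^1 = 0, dimension shifting gives the higher Ext, and biduality
then follows from the bidual of a free cover.

From R to S: a finitely generated ideal I of S has a finitely generated preimage J in R, and I =
J/xR with xR free. So I is a finitely presented R-module of finite G-dimension modulo a finite free
submodule (`HasLiftedGDimLE`). For a cover S^m → N with kernel K, the kernel Ω of R^m → N contains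
xR^m and Ω/xR^m = K; hence the property passes to syzygies with the bound on the G-dimension
dropping by one. At bound 0 it also passes to duals, since Hom_S(N,S) ≅ Ext^1_R(N,R) = Ω^*/(R^m)^*,
and the criterion applies.

From S to R: cover an ideal I of R by R^m with kernel K. As x is regular on I, K/xK embeds in S^m,
so it has finite G-dimension (`exists_hasGDimLE_of_injective`). G-dimension bounds lift from K/xK to
K (`IsRegularReduction.hasGDimLE`): reduction modulo a regular x commutes with syzygies and, once
functionals extend, with duals; Nakayama's lemma makes functionals extend over R when they do over
S. -/

/-! ### Vanishing of Ext along short exact sequences. -/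

section Ext

open CategoryTheory Abelian

variable {R : Type u} [CommRing R] {A B C : Type u} [AddCommGroup A] [Module R A]
  [AddCommGroup B] [Module R B] [AddCommGroup C] [Module R C]
  {f : A →ₗ[R] B} {g : B →ₗ[R] C}

/-- `Ext^i_R(M, R) = 0`. -/
def ExtZero (R : Type u) [CommRing R] (M : Type u) [AddCommGroup M] [Module R M] (i : ℕ) : Prop :=
  Subsingleton (Ext (ModuleCat.of R M) (ModuleCat.of R R) i)

/-- The short exact sequence of modules `0 → A → B → C → 0` in `ModuleCat R`. -/
lemma shortExact_ofHom (hf : Function.Injective f) (hfg : Function.Exact f g)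
    (hg : Function.Surjective g) :
    (ShortComplex.mk (ModuleCat.ofHom f) (ModuleCat.ofHom g)
      (by ext a; exact hfg.apply_apply_eq_zero a)).ShortExact :=
  ModuleCat.shortComplex_shortExact _ hfg hf hg

lemma ExtZero.dualMap_surjective (hf : Function.Injective f) (hfg : Function.Exact f g)
    (hg : Function.Surjective g) (h : ExtZero R C 1) : Function.Surjective f.dualMap := by
  intro φ
  have hS := shortExact_ofHom hf hfg hg
  have h' : Subsingleton (Ext (ModuleCat.of R C) (ModuleCat.of R R) 1) := h
  obtain ⟨y, hy⟩ := Ext.contravariant_sequence_exact₁ hS (ModuleCat.of R R)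
    (Ext.mk₀ (ModuleCat.ofHom φ)) (n₁ := 1) rfl (h'.elim _ _)
  obtain ⟨ψ, rfl⟩ := Ext.addEquiv₀.symm.surjective y
  refine ⟨ψ.hom, ?_⟩
  have : Ext.mk₀ (ModuleCat.ofHom f ≫ ψ) = Ext.mk₀ (ModuleCat.ofHom φ) := by
    rw [← hy, ← Ext.mk₀_comp_mk₀]; rfl
  have h2 := Ext.addEquiv₀.symm.injective this
  exact congrArg ModuleCat.Hom.hom h2

/-- Since Ext^1(B,R) = 0, every class in Ext^1(C,R) is the connecting image of a functional on A; as
that functional extends to B, the class is zero. -/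
lemma ExtZero.one_of_dualMap_surjective (hf : Function.Injective f) (hfg : Function.Exact f g)
    (hg : Function.Surjective g) (h : Function.Surjective f.dualMap) (hB : ExtZero R B 1) :
    ExtZero R C 1 := by
  have hS := shortExact_ofHom hf hfg hg
  have hB' : Subsingleton (Ext (ModuleCat.of R B) (ModuleCat.of R R) 1) := hB
  refine subsingleton_of_forall_eq 0 fun z => ?_
  obtain ⟨y, rfl⟩ := Ext.contravariant_sequence_exact₃ hS (ModuleCat.of R R) z
    (hB'.elim _ _) (n₀ := 0) rfl
  obtain ⟨φ, rfl⟩ := Ext.addEquiv₀.symm.surjective y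
  obtain ⟨ψ, hψ⟩ := h φ.hom
  have : φ = ModuleCat.ofHom f ≫ ModuleCat.ofHom ψ := by
    ext a; exact (LinearMap.congr_fun hψ a).symm
  have e : Ext.addEquiv₀.symm φ =
      (Ext.mk₀ (ModuleCat.ofHom f)).comp (Ext.mk₀ (ModuleCat.ofHom ψ)) (zero_add 0) := by
    rw [Ext.mk₀_comp_mk₀, this]; rfl
  rw [e]
  exact hS.extClass_comp_assoc _

lemma ExtZero.succ_right (hf : Function.Injective f) (hfg : Function.Exact f g)
    (hg : Function.Surjective g) {i : ℕ} (hA : ExtZero R A i) (hB : ExtZero R B (i + 1)) :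
    ExtZero R C (i + 1) := by
  have hS := shortExact_ofHom hf hfg hg
  have hA' : Subsingleton (Ext (ModuleCat.of R A) (ModuleCat.of R R) i) := hA
  have hB' : Subsingleton (Ext (ModuleCat.of R B) (ModuleCat.of R R) (i + 1)) := hB
  refine subsingleton_of_forall_eq 0 fun z => ?_
  obtain ⟨y, rfl⟩ := Ext.contravariant_sequence_exact₃ hS (ModuleCat.of R R) z
    (hB'.elim _ _) (n₀ := i) (add_comm _ _)
  rw [hA'.elim y 0, Ext.comp_zero]

lemma ExtZero.middle (hf : Function.Injective f) (hfg : Function.Exact f g)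
    (hg : Function.Surjective g) {i : ℕ} (hA : ExtZero R A i) (hC : ExtZero R C i) :
    ExtZero R B i := by
  have hS := shortExact_ofHom hf hfg hg
  have hA' : Subsingleton (Ext (ModuleCat.of R A) (ModuleCat.of R R) i) := hA
  have hC' : Subsingleton (Ext (ModuleCat.of R C) (ModuleCat.of R R) i) := hC
  refine subsingleton_of_forall_eq 0 fun z => ?_
  obtain ⟨y, rfl⟩ := Ext.contravariant_sequence_exact₂ hS (ModuleCat.of R R) z (hA'.elim _ _)
  rw [hC'.elim y 0, Ext.comp_zero]

lemma ExtZero.left (hf : Function.Injective f) (hfg : Function.Exact f g)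
    (hg : Function.Surjective g) {i : ℕ} (hB : ExtZero R B i) (hC : ExtZero R C (i + 1)) :
    ExtZero R A i := by
  have hS := shortExact_ofHom hf hfg hg
  have hB' : Subsingleton (Ext (ModuleCat.of R B) (ModuleCat.of R R) i) := hB
  have hC' : Subsingleton (Ext (ModuleCat.of R C) (ModuleCat.of R R) (i + 1)) := hC
  refine subsingleton_of_forall_eq 0 fun z => ?_
  obtain ⟨y, rfl⟩ := Ext.contravariant_sequence_exact₁ hS (ModuleCat.of R R) z (n₁ := i + 1)
    (add_comm _ _) (hC'.elim _ _)
  rw [hB'.elim y 0, Ext.comp_zero]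

lemma extZero_of_projective (M : Type u) [AddCommGroup M] [Module R M] [Module.Projective R M]
    (i : ℕ) : ExtZero R M (i + 1) := by
  have : Projective (ModuleCat.of R M) := (IsProjective.iff_projective M).mp inferInstance
  exact Ext.subsingleton_of_projective _ _ _

lemma extVanishes_iff (M : Type u) [AddCommGroup M] [Module R M] :
    ExtVanishes R M ↔ ∀ i, ExtZero R M (i + 1) :=
  ⟨fun h i => h (i + 1) i.succ_pos, fun h i hi => by
    obtain ⟨j, rfl⟩ := Nat.exists_eq_succ_of_ne_zero hi.ne'
    exact h j⟩

lemma ExtVanishes.of_projective (M : Type u) [AddCommGroup M] [Module R M]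
    [Module.Projective R M] : ExtVanishes R M :=
  (extVanishes_iff M).2 (extZero_of_projective M)

lemma ExtVanishes.dualMap_surjective (hf : Function.Injective f) (hfg : Function.Exact f g)
    (hg : Function.Surjective g) (h : ExtVanishes R C) : Function.Surjective f.dualMap :=
  ExtZero.dualMap_surjective hf hfg hg (h 1 one_pos)

lemma ExtVanishes.middle (hf : Function.Injective f) (hfg : Function.Exact f g)
    (hg : Function.Surjective g) (hA : ExtVanishes R A) (hC : ExtVanishes R C) :
    ExtVanishes R B :=
  fun i hi => ExtZero.middle hf hfg hg (hA i hi) (hC i hi)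

lemma ExtVanishes.left (hf : Function.Injective f) (hfg : Function.Exact f g)
    (hg : Function.Surjective g) (hB : ExtVanishes R B) (hC : ExtVanishes R C) :
    ExtVanishes R A :=
  fun i hi => ExtZero.left hf hfg hg (hB i hi) (hC (i + 1) i.succ_pos)

lemma ExtVanishes.right (hf : Function.Injective f) (hfg : Function.Exact f g)
    (hg : Function.Surjective g) (hA : ExtVanishes R A) (hB : ExtVanishes R B)
    (h : Function.Surjective f.dualMap) : ExtVanishes R C := by
  rw [extVanishes_iff] at *
  rintro (_ | i)
  · exact ExtZero.one_of_dualMap_surjective hf hfg hg h (hB 0)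
  · exact ExtZero.succ_right hf hfg hg (hA i) (hB (i + 1))

lemma ExtVanishes.of_linearEquiv (e : A ≃ₗ[R] B) (h : ExtVanishes R B) : ExtVanishes R A :=
  ExtVanishes.middle (f := (0 : PUnit.{u + 1} →ₗ[R] A)) (g := e.toLinearMap)
    (fun _ _ _ => Subsingleton.elim _ _)
    (fun a => ⟨fun ha => ⟨0, (e.injective (ha.trans (map_zero e).symm)).symm⟩, by rintro ⟨_, rfl⟩; simp⟩)
    e.surjective (ExtVanishes.of_projective _) h

end Ext

/-! ### Closure properties of the G-class and the criterion for membership. -/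

section GClass

/-- A semilinear map vanishing on the kernel of a surjective semilinear map factors through it. -/
lemma exists_factor_of_ker {R S A N T : Type*} [CommRing R] [CommRing S] {π : R →+* S}
    [RingHomSurjective π] [AddCommGroup A] [Module R A] [AddCommGroup N] [Module S N]
    [AddCommGroup T] [Module S T] (q : A →ₛₗ[π] N) (hq : Function.Surjective q)
    (φ : A →ₛₗ[π] T) (h : ∀ a, q a = 0 → φ a = 0) : ∃ ψ : N →ₗ[S] T, ∀ a, ψ (q a) = φ a := by
  have key : ∀ a b, q a = q b → φ a = φ b := fun a b hab => by
    rw [← sub_eq_zero, ← map_sub]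
    exact h _ (by rw [map_sub, hab, sub_self])
  have hs := Function.surjInv_eq hq
  refine ⟨{ toFun := fun n => φ (Function.surjInv hq n), map_add' := ?_, map_smul' := ?_ },
    fun a => key _ _ (hs _)⟩
  · intro m n
    rw [← map_add]
    exact key _ _ (by rw [hs, map_add, hs, hs])
  · intro s n
    obtain ⟨r, rfl⟩ := RingHom.surjective π s
    rw [RingHom.id_apply, ← LinearMap.map_smulₛₗ]
    exact key _ _ (by rw [hs, LinearMap.map_smulₛₗ, hs])

variable {R : Type u} [CommRing R] {A B C : Type u} [AddCommGroup A] [Module R A]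
  [AddCommGroup B] [Module R B] [AddCommGroup C] [Module R C]
  {f : A →ₗ[R] B} {g : B →ₗ[R] C}

lemma exact_dualMap (hfg : Function.Exact f g) (hg : Function.Surjective g) :
    Function.Exact g.dualMap f.dualMap := by
  intro φ
  constructor
  · intro h
    obtain ⟨ψ, hψ⟩ := exists_factor_of_ker g hg φ (fun b hb => by
      obtain ⟨a, rfl⟩ := (hfg b).1 hb
      exact LinearMap.congr_fun h a)
    exact ⟨ψ, LinearMap.ext hψ⟩
  · rintro ⟨ψ, rfl⟩
    ext a
    simp [hfg.apply_apply_eq_zero]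

lemma dualMap_injective (hg : Function.Surjective g) : Function.Injective g.dualMap :=
  LinearMap.dualMap_injective_of_surjective hg

lemma finite_of_exact (hfg : Function.Exact f g) (hg : Function.Surjective g)
    [Module.Finite R A] [Module.Finite R C] : Module.Finite R B := by
  refine ⟨Submodule.fg_of_fg_map_of_fg_inf_ker g ?_ ?_⟩
  · rw [Submodule.map_top, LinearMap.range_eq_top.2 hg]; exact Module.Finite.fg_top
  · rw [top_inf_eq, LinearMap.exact_iff.1 hfg]; exact Submodule.fg_range f

lemma IsGClass.of_linearEquiv (e : A ≃ₗ[R] B) (h : IsGClass R B) : IsGClass R A where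
  finite := have := h.finite; Module.Finite.equiv e.symm
  extVanishes := h.extVanishes.of_linearEquiv e
  extVanishes_dual := h.extVanishes_dual.of_linearEquiv e.symm.dualMap
  bijective_eval := by
    have : (e.dualMap.dualMap ∘ Module.Dual.eval R A) = Module.Dual.eval R B ∘ e := by
      ext a φ; simp
    exact (Function.Bijective.of_comp_iff' (e.dualMap.dualMap).bijective _).1
      (this ▸ h.bijective_eval.comp e.bijective)

lemma IsGClass.of_free (P : Type u) [AddCommGroup P] [Module R P] [Module.Free R P]
    [Module.Finite R P] : IsGClass R P where
  finite := inferInstance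
  extVanishes := .of_projective P
  extVanishes_dual := .of_projective _
  bijective_eval := Module.bijective_dual_eval R P

lemma IsGClass.dual (h : IsGClass R A) [Module.Finite R (Module.Dual R A)] :
    IsGClass R (Module.Dual R A) where
  finite := inferInstance
  extVanishes := h.extVanishes_dual
  extVanishes_dual := h.extVanishes.of_linearEquiv (LinearEquiv.ofBijective _ h.bijective_eval).symm
  bijective_eval := by
    let e := LinearEquiv.ofBijective _ h.bijective_eval
    have : (e.dualMap ∘ Module.Dual.eval R (Module.Dual R A)) = id := by
      ext φ a; rfl
    exact (Function.Bijective.of_comp_iff' e.dualMap.bijective _).1 (this ▸ Function.bijective_id)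

/-- Because Ext^1(C,R) = 0, the dual sequence is short exact; biduality for B is then a five-lemma
chase. -/
lemma IsGClass.middle (hf : Function.Injective f) (hfg : Function.Exact f g)
    (hg : Function.Surjective g) (hA : IsGClass R A) (hC : IsGClass R C) : IsGClass R B := by
  have hsurj := hC.extVanishes.dualMap_surjective hf hfg hg
  have hex := exact_dualMap hfg hg
  refine ⟨?_, .middle hf hfg hg hA.extVanishes hC.extVanishes,
    .middle (dualMap_injective hg) hex hsurj hC.extVanishes_dual hA.extVanishes_dual, ?_, ?_⟩
  · have := hA.finite
    have := hC.finite
    exact finite_of_exact hfg hg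
  · rw [injective_iff_map_eq_zero]
    intro b hb
    have h1 : Module.Dual.eval R C (g b) = g.dualMap.dualMap (Module.Dual.eval R B b) := rfl
    rw [hb, map_zero] at h1
    obtain ⟨a, rfl⟩ := (hfg b).1 ((injective_iff_map_eq_zero _).1 hC.bijective_eval.1 _ h1)
    have h2 : f.dualMap.dualMap (Module.Dual.eval R A a) = 0 := hb
    rw [(injective_iff_map_eq_zero _).1 hA.bijective_eval.1 a
      ((injective_iff_map_eq_zero _).1 (dualMap_injective hsurj) _ h2), map_zero]
  · intro β
    obtain ⟨c, hc⟩ := hC.bijective_eval.2 (g.dualMap.dualMap β)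
    obtain ⟨b, rfl⟩ := hg c
    obtain ⟨α, hα⟩ := (exact_dualMap hex hsurj (β - Module.Dual.eval R B b)).1 (by
      rw [map_sub, ← hc, sub_eq_zero]; rfl)
    obtain ⟨a, rfl⟩ := hA.bijective_eval.2 α
    refine ⟨b + f a, ?_⟩
    rw [map_add, ← eq_sub_iff_add_eq', ← hα]
    rfl

/-- The delicate point is Ext^1(A^*,R) = 0: it needs B^** → C^** to be onto, which follows from B →
C being onto and C being reflexive. -/
lemma IsGClass.left (hf : Function.Injective f) (hfg : Function.Exact f g)
    (hg : Function.Surjective g) [Module.Finite R A] (hB : IsGClass R B) (hC : IsGClass R C) :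
    IsGClass R A := by
  have hsurj := hC.extVanishes.dualMap_surjective hf hfg hg
  have hex := exact_dualMap hfg hg
  refine ⟨inferInstance, .left hf hfg hg hB.extVanishes hC.extVanishes,
    .right (dualMap_injective hg) hex hsurj hC.extVanishes_dual hB.extVanishes_dual ?_, ?_, ?_⟩
  · intro γ
    obtain ⟨c, rfl⟩ := hC.bijective_eval.2 γ
    obtain ⟨b, rfl⟩ := hg c
    exact ⟨Module.Dual.eval R B b, rfl⟩
  · intro a a' h
    exact hf (hB.bijective_eval.1 (congrArg f.dualMap.dualMap h))
  · intro α
    obtain ⟨b, hb⟩ := hB.bijective_eval.2 (f.dualMap.dualMap α)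
    have h1 : Module.Dual.eval R C (g b) = g.dualMap.dualMap (Module.Dual.eval R B b) := rfl
    rw [hb, (exact_dualMap hex hsurj).apply_apply_eq_zero] at h1
    obtain ⟨a, rfl⟩ := (hfg b).1 ((injective_iff_map_eq_zero _).1 hC.bijective_eval.1 _ h1)
    exact ⟨a, dualMap_injective hsurj hb⟩

lemma exact_subtype_ker (g : B →ₗ[R] C) : Function.Exact (LinearMap.ker g).subtype g :=
  LinearMap.exact_subtype_ker_map g

/-- A class of modules closed under duals and (suitable) syzygies, in which functionals on the
syzygies extend, lies in the G-class: biduality comes for free. -/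
lemma isGClass_of_syzygy_of_dual (𝒞 : ∀ (M : Type u) [AddCommGroup M] [Module R M], Prop)
    (syz : ∀ (M : Type u) [AddCommGroup M] [Module R M], 𝒞 M →
      ∃ (n : ℕ) (p : (Fin n → R) →ₗ[R] M), Function.Surjective p ∧
        Function.Surjective (LinearMap.ker p).subtype.dualMap ∧ 𝒞 (LinearMap.ker p))
    (dual : ∀ (M : Type u) [AddCommGroup M] [Module R M], 𝒞 M → 𝒞 (Module.Dual R M))
    (M : Type u) [AddCommGroup M] [Module R M] (hM : 𝒞 M) : IsGClass R M := by
  have ext : ∀ (i : ℕ) (M : Type u) [AddCommGroup M] [Module R M], 𝒞 M →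
      ExtZero R M (i + 1) := by
    intro i
    induction i with
    | zero =>
      intro M _ _ hM
      obtain ⟨n, p, hp, hd, -⟩ := syz M hM
      exact ExtZero.one_of_dualMap_surjective (Submodule.subtype_injective _)
        (exact_subtype_ker p) hp hd (extZero_of_projective _ _)
    | succ i ih =>
      intro M _ _ hM
      obtain ⟨n, p, hp, -, hK⟩ := syz M hM
      exact ExtZero.succ_right (Submodule.subtype_injective _)
        (exact_subtype_ker p) hp (ih _ hK) (extZero_of_projective _ _)
  have surj : ∀ (M : Type u) [AddCommGroup M] [Module R M], 𝒞 M →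
      Function.Surjective (Module.Dual.eval R M) := by
    intro M _ _ hM β
    obtain ⟨n, p, hp, hd, hK⟩ := syz M hM
    -- The dual of the kernel is again in the class, so its Ext^1 vanishes and the bidual of the
    -- free module maps onto M^**.
    obtain ⟨β', rfl⟩ := ExtZero.dualMap_surjective (dualMap_injective hp)
      (exact_dualMap (exact_subtype_ker p) hp) hd (ext 0 _ (dual _ hK)) β
    obtain ⟨u, rfl⟩ := (Module.bijective_dual_eval R (Fin n → R)).2 β'
    exact ⟨p u, rfl⟩
  obtain ⟨n, p, hp, hd, hK⟩ := syz M hM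
  refine ⟨.of_surjective p hp, (extVanishes_iff M).2 fun i => ext i M hM,
    (extVanishes_iff _).2 fun i => ext i _ (dual M hM), ?_, surj M hM⟩
  rw [injective_iff_map_eq_zero]
  intro m hm
  obtain ⟨u, rfl⟩ := hp m
  -- If `p u` dies in M^**, the image of u in the bidual of the free module comes from the bidual of
  -- the kernel, hence from an element of the kernel, which must be u.
  obtain ⟨κ, hκ⟩ := (exact_dualMap (exact_dualMap (exact_subtype_ker p) hp) hd
    (Module.Dual.eval R _ u)).1 hm
  obtain ⟨k, rfl⟩ := surj _ hK κ
  have : (k : Fin n → R) = u := (Module.bijective_dual_eval R (Fin n → R)).1 hκ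
  rw [← this]
  exact k.2

end GClass

/-! ### G-dimension by iterated short exact sequences, and comparison with resolutions. -/

section GDim

/-- `M` has a G-resolution of length at most `n`. -/
def HasGDimLE (R : Type u) [CommRing R] :
    ℕ → ∀ (M : Type u) [AddCommGroup M] [Module R M], Prop
  | 0, M, _, _ => IsGClass R M
  | n + 1, M, _, _ => ∃ (L G : ModuleCat.{u} R) (i : L →ₗ[R] G) (f : G →ₗ[R] M),
      Function.Injective i ∧ Function.Exact i f ∧ Function.Surjective f ∧ IsGClass R G ∧
        HasGDimLE R n L

variable {R : Type u} [CommRing R]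

lemma HasGDimLE.of_exact {n : ℕ} {L G M : Type u} [AddCommGroup L] [Module R L]
    [AddCommGroup G] [Module R G] [AddCommGroup M] [Module R M] {i : L →ₗ[R] G} {f : G →ₗ[R] M}
    (hi : Function.Injective i) (hif : Function.Exact i f) (hf : Function.Surjective f)
    (hG : IsGClass R G) (hL : HasGDimLE R n L) : HasGDimLE R (n + 1) M :=
  ⟨ModuleCat.of R L, ModuleCat.of R G, i, f, hi, hif, hf, hG, hL⟩

lemma HasGDimLE.finite {n : ℕ} {M : Type u} [AddCommGroup M] [Module R M]
    (h : HasGDimLE R n M) : Module.Finite R M := by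
  cases n with
  | zero => exact IsGClass.finite h
  | succ n =>
    obtain ⟨L, G, i, f, -, -, hf, hG, -⟩ := h
    have := hG.finite
    exact .of_surjective f hf

lemma HasGDimLE.of_linearEquiv {n : ℕ} {M N : Type u} [AddCommGroup M] [Module R M]
    [AddCommGroup N] [Module R N] (e : M ≃ₗ[R] N) (h : HasGDimLE R n N) : HasGDimLE R n M := by
  cases n with
  | zero => exact IsGClass.of_linearEquiv e h
  | succ n =>
    obtain ⟨L, G, i, f, hi, hif, hf, hG, hL⟩ := h
    refine .of_exact (f := e.symm.toLinearMap ∘ₗ f) hi (fun g => ?_) (e.symm.surjective.comp hf)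
      hG hL
    rw [← hif g]
    simp

lemma HasGDimLE.succ {n : ℕ} {M : Type u} [AddCommGroup M] [Module R M]
    (h : HasGDimLE R n M) : HasGDimLE R (n + 1) M := by
  induction n generalizing M with
  | zero =>
    refine .of_exact (L := PUnit) (G := M) (i := 0) (f := LinearMap.id)
      (fun _ _ _ => Subsingleton.elim _ _) (fun a => ?_) Function.surjective_id h
      (IsGClass.of_free PUnit)
    simp [eq_comm]
  | succ n ih =>
    obtain ⟨L, G, i, f, hi, hif, hf, hG, hL⟩ := h
    exact .of_exact hi hif hf hG (ih hL)

lemma HasGDimLE.mono {m n : ℕ} (hmn : m ≤ n) {M : Type u} [AddCommGroup M] [Module R M]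
    (h : HasGDimLE R m M) : HasGDimLE R n M := by
  induction hmn with
  | refl => exact h
  | step _ ih => exact ih.succ

/-- The kernel of a surjection from a free module has smaller G-dimension. -/
lemma HasGDimLE.of_free_cover {n : ℕ} {M : Type u} [AddCommGroup M] [Module R M]
    (h : HasGDimLE R n M) {K P : Type u} [AddCommGroup P] [Module R P] [Module.Free R P]
    [Module.Finite R P] [AddCommGroup K] [Module R K] [Module.Finite R K] {j : K →ₗ[R] P}
    {p : P →ₗ[R] M} (hj : Function.Injective j) (hjp : Function.Exact j p)
    (hp : Function.Surjective p) : HasGDimLE R (n - 1) K := by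
  cases n with
  | zero => exact IsGClass.left hj hjp hp (.of_free P) h
  | succ n =>
    obtain ⟨L, G, i, f, hi, hif, hf, hG, hL⟩ := h
    obtain ⟨s, hs⟩ := Module.projective_lifting_property f p hf
    have hs' : ∀ u, f (s u) = p u := LinearMap.congr_fun hs
    have lift : ∀ k, ∃ l, i l = s (j k) := fun k =>
      (hif _).1 (by rw [hs', hjp.apply_apply_eq_zero])
    cases n with
    | zero =>
      choose l hl using lift
      let t : K →ₗ[R] L :=
        { toFun := l
          map_add' := fun a b => hi (by simp only [hl, map_add])
          map_smul' := fun r a => hi (by simp only [hl, map_smul, RingHom.id_apply]) }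
      have ht : ∀ k, i (t k) = s (j k) := hl
      -- With `s` lifting `p` to G, the mapping cone gives an exact sequence 0 → K → L × P → G → 0.
      have hLP : IsGClass R (L × P) :=
        .middle (f := LinearMap.inl R L P) (g := LinearMap.snd R L P) LinearMap.inl_injective
          .inl_snd LinearMap.snd_surjective hL (.of_free P)
      refine IsGClass.left (f := (-t).prod j) (g := i.coprod s) ?_ ?_ ?_ hLP hG
      · exact fun a b hab => hj (congrArg Prod.snd hab)
      · rintro ⟨a, u⟩
        constructor
        · intro h0
          have h0 : i a + s u = 0 := h0
          obtain ⟨k, rfl⟩ := (hjp u).1 (by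
            simpa [hif.apply_apply_eq_zero, hs'] using congrArg f h0)
          refine ⟨k, Prod.ext (hi ?_) rfl⟩
          simp [ht, eq_neg_of_add_eq_zero_left h0]
        · rintro ⟨k, hk⟩
          rw [← hk]
          simp [ht]
      · intro g
        obtain ⟨u, hu⟩ := hp (f g)
        obtain ⟨a, ha⟩ := (hif (g - s u)).1 (by rw [map_sub, hs', hu, sub_self])
        exact ⟨(a, u), by simp [ha]⟩
    | succ n =>
      obtain ⟨L', G', i', f', hi', hif', hf', hG', hL'⟩ := hL
      have hGP : IsGClass R (G' × P) :=
        .middle (f := LinearMap.inl R G' P) (g := LinearMap.snd R G' P) LinearMap.inl_injective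
          .inl_snd LinearMap.snd_surjective hG' (.of_free P)
      -- Replacing L by its cover G' keeps the cone inside the G-class: ker Ψ is in the G-class and
      -- 0 → L' → ker Ψ → K → 0 is exact.
      let Ψ : G' × P →ₗ[R] G := (i ∘ₗ f').coprod s
      have hΨ : ∀ w, Ψ w = i (f' w.1) + s w.2 := fun w => rfl
      have hΨs : Function.Surjective Ψ := by
        intro g
        obtain ⟨u, hu⟩ := hp (f g)
        obtain ⟨a, ha⟩ := (hif (g - s u)).1 (by rw [map_sub, hs', hu, sub_self])
        obtain ⟨b, rfl⟩ := hf' a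
        exact ⟨(b, u), by simp [hΨ, ha]⟩
      have mem : ∀ w ∈ LinearMap.ker Ψ, p w.2 = 0 := by
        intro w hw
        have h0 : i (f' w.1) + s w.2 = 0 := hw
        simpa [hif.apply_apply_eq_zero, hs'] using congrArg f h0
      have h2 : ∀ w : LinearMap.ker Ψ, ∃ k, j k = w.1.2 := fun w => (hjp _).1 (mem _ w.2)
      choose κ hκ using h2
      let q : LinearMap.ker Ψ →ₗ[R] K :=
        { toFun := κ
          map_add' := fun a b => hj (by simp [hκ])
          map_smul' := fun r a => hj (by simp [hκ]) }
      have hq : ∀ w, j (q w) = w.1.2 := hκ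
      let ι : L' →ₗ[R] LinearMap.ker Ψ :=
        LinearMap.codRestrict _ (LinearMap.inl R G' P ∘ₗ i') fun a => by
          simp [hΨ, hif'.apply_apply_eq_zero]
      have hι : Function.Injective ι := fun a b hab =>
        hi' (congrArg (fun w : LinearMap.ker Ψ => w.1.1) hab)
      have hιq : Function.Exact ι q := by
        intro w
        constructor
        · intro h0
          have h1 : w.1.2 = 0 := by rw [← hq, h0, map_zero]
          have h3 : i (f' w.1.1) + s w.1.2 = 0 := w.2
          rw [h1, map_zero, add_zero] at h3
          obtain ⟨a, ha⟩ := (hif' _).1 ((injective_iff_map_eq_zero _).1 hi _ h3)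
          exact ⟨a, Subtype.ext (Prod.ext ha h1.symm)⟩
        · rintro ⟨a, rfl⟩
          exact hj (by rw [hq, map_zero]; rfl)
      have hqs : Function.Surjective q := by
        intro k
        obtain ⟨a, ha⟩ := lift k
        obtain ⟨b, rfl⟩ := hf' a
        exact ⟨⟨(-b, j k), by simp [hΨ, ha]⟩, hj (hq _)⟩
      have := hL'.finite
      have := finite_of_exact hιq hqs
      exact .of_exact hι hιq hqs
        (.left (Submodule.subtype_injective _) (exact_subtype_ker Ψ) hΨs hGP hG) hL'

/-- Splicing a short exact sequence onto a G-resolution. -/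
def GResolution.cons {L G M : Type u} [AddCommGroup L] [Module R L]
    [AddCommGroup G] [Module R G] [AddCommGroup M] [Module R M] {i : L →ₗ[R] G} {f : G →ₗ[R] M}
    (hi : Function.Injective i) (hif : Function.Exact i f) (hf : Function.Surjective f)
    (hG : IsGClass R G) (P : GResolution R L) : GResolution R M where
  G
    | 0 => ModuleCat.of R G
    | n + 1 => P.G n
  d
    | 0 => i ∘ₗ P.aug
    | n + 1 => P.d n
  aug := f
  isGClass
    | 0 => hG
    | n + 1 => P.isGClass n
  exact_d
    | 0 => fun a => by
      rw [← P.exact_aug a]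
      exact (injective_iff_map_eq_zero' i).1 hi _
    | n + 1 => P.exact_d n
  exact_aug := fun g => by
    rw [hif g]
    constructor
    · rintro ⟨l, rfl⟩
      obtain ⟨a, rfl⟩ := P.surjective_aug l
      exact ⟨a, rfl⟩
    · rintro ⟨a, rfl⟩
      exact ⟨_, rfl⟩
  surjective_aug := hf

/-- The G-resolution of length zero of a module in the G-class. -/
def GResolution.single {M : Type u} [AddCommGroup M] [Module R M] (hM : IsGClass R M) :
    GResolution R M where
  G
    | 0 => ModuleCat.of R M
    | _ + 1 => ModuleCat.of R PUnit
  d _ := 0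
  aug := LinearMap.id
  isGClass
    | 0 => hM
    | _ + 1 => IsGClass.of_free PUnit
  exact_d _ := fun a => ⟨fun _ => ⟨0, Subsingleton.elim (α := PUnit) _ _⟩, fun _ => rfl⟩
  exact_aug := fun a => ⟨fun h => ⟨0, h.symm⟩, by rintro ⟨_, rfl⟩; rfl⟩
  surjective_aug := Function.surjective_id

lemma HasGDimLE.exists_gResolution {n : ℕ} {M : Type u} [AddCommGroup M] [Module R M]
    (h : HasGDimLE R n M) : ∃ P : GResolution R M, ∀ i, n < i → Subsingleton (P.G i) := by
  induction n generalizing M with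
  | zero =>
    refine ⟨.single h, fun i hi => ?_⟩
    obtain ⟨j, rfl⟩ := Nat.exists_eq_succ_of_ne_zero hi.ne'
    exact inferInstanceAs (Subsingleton PUnit)
  | succ n ih =>
    obtain ⟨L, G, i, f, hi, hif, hf, hG, hL⟩ := h
    obtain ⟨P, hP⟩ := ih hL
    refine ⟨.cons hi hif hf hG P, fun k hk => ?_⟩
    obtain ⟨j, rfl⟩ := Nat.exists_eq_succ_of_ne_zero (Nat.ne_zero_of_lt hk)
    exact hP j (by omega)

/-- Truncating a G-resolution at its first syzygy. -/
def GResolution.tail {M : Type u} [AddCommGroup M] [Module R M] (P : GResolution R M) :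
    GResolution R (LinearMap.ker P.aug) where
  G n := P.G (n + 1)
  d n := P.d (n + 1)
  aug := LinearMap.codRestrict _ (P.d 0) fun a => P.exact_aug.apply_apply_eq_zero a
  isGClass n := P.isGClass (n + 1)
  exact_d n := P.exact_d (n + 1)
  exact_aug := fun a => by
    rw [← P.exact_d 0 a, ← Submodule.coe_eq_zero]
    rfl
  surjective_aug := fun a => by
    obtain ⟨b, hb⟩ := (P.exact_aug a).1 a.2
    exact ⟨b, Subtype.ext hb⟩

lemma GResolution.hasGDimLE {n : ℕ} {M : Type u} [AddCommGroup M] [Module R M]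
    (P : GResolution R M) (hP : ∀ i, n < i → Subsingleton (P.G i)) : HasGDimLE R n M := by
  induction n generalizing M with
  | zero =>
    have hinj : Function.Injective P.aug := by
      rw [injective_iff_map_eq_zero]
      intro a ha
      obtain ⟨b, rfl⟩ := (P.exact_aug a).1 ha
      have := hP 1 one_pos
      rw [Subsingleton.elim b 0, map_zero]
    exact IsGClass.of_linearEquiv (LinearEquiv.ofBijective P.aug ⟨hinj, P.surjective_aug⟩).symm
      (P.isGClass 0)
  | succ n ih =>
    exact .of_exact (Submodule.subtype_injective _) (exact_subtype_ker P.aug) P.surjective_aug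
      (P.isGClass 0) (ih P.tail fun i hi => hP (i + 1) (by omega))

lemma gDim_lt_top_iff (M : Type u) [AddCommGroup M] [Module R M] :
    gDim R M < ⊤ ↔ ∃ n, HasGDimLE R n M := by
  constructor
  · intro h
    obtain ⟨P, hP⟩ := iInf_lt_iff.1 h
    obtain ⟨n, hn⟩ := ENat.ne_top_iff_exists.1 hP.ne
    refine ⟨n, P.hasGDimLE fun i hi => ?_⟩
    by_contra hne
    rw [not_subsingleton_iff_nontrivial] at hne
    have h1 : (i : ℕ∞) ≤ P.length :=
      le_iSup (fun k : {k : ℕ // Nontrivial (P.G k)} => ((k : ℕ) : ℕ∞)) ⟨i, hne⟩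
    rw [← hn] at h1
    exact absurd (Nat.cast_le.1 h1) (not_le.2 hi)
  · rintro ⟨n, h⟩
    obtain ⟨P, hP⟩ := h.exists_gResolution
    refine lt_of_le_of_lt (iInf_le _ P) (lt_of_le_of_lt (iSup_le ?_) (ENat.natCast_lt_top n))
    rintro ⟨i, hi⟩
    by_contra hlt
    have := hP i (by simpa using hlt)
    exact not_nontrivial _ hi

end GDim

/-! ### Finite presentation of kernels and duals over a coherent ring. -/

section Coherent

variable {R : Type u} [CommRing R] [IsCoherentRing R]

/-- Impose the coordinates one at a time: on the kernel of the others, covered by a free module, the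
last one has a finitely generated ideal as image, so coherence makes its relations finitely
generated. -/
lemma fg_ker_of_pi {k n : ℕ} (f : (Fin k → R) →ₗ[R] (Fin n → R)) : (LinearMap.ker f).FG := by
  induction n with
  | zero =>
    have : LinearMap.ker f = ⊤ := by
      ext v
      simpa using Subsingleton.elim _ _
    rw [this]
    exact Module.Finite.fg_top
  | succ n ih =>
    let g : (Fin k → R) →ₗ[R] (Fin n → R) := LinearMap.funLeft R R Fin.succ ∘ₗ f
    have : Module.Finite R (LinearMap.ker g) := .of_fg (ih g)
    obtain ⟨l, h, hh⟩ := Module.Finite.exists_fin' R (LinearMap.ker g)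
    let c : (Fin l → R) →ₗ[R] R :=
      LinearMap.proj 0 ∘ₗ f ∘ₗ (LinearMap.ker g).subtype ∘ₗ h
    have hc : Module.FinitePresentation R (LinearMap.range c) :=
      IsCoherentRing.finitePresentation_of_fg _ (Submodule.fg_range c)
    have hk := Module.FinitePresentation.fg_ker c.rangeRestrict c.surjective_rangeRestrict
    rw [LinearMap.ker_rangeRestrict] at hk
    convert hk.map ((LinearMap.ker g).subtype ∘ₗ h)
    ext v
    simp only [Submodule.mem_map, LinearMap.mem_ker, LinearMap.comp_apply, c]
    constructor
    · intro hv
      obtain ⟨w, hw⟩ := hh ⟨v, by simp [g, hv]⟩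
      exact ⟨w, by simp [hw, hv], by simp [hw]⟩
    · rintro ⟨w, h0, rfl⟩
      have h1 : g (h w) = 0 := (h w).2
      ext j
      refine Fin.cases h0 (fun i => ?_) j
      exact congrFun h1 i

variable {P Q M : Type u} [AddCommGroup P] [Module R P] [Module.Finite R P]
  [AddCommGroup Q] [Module R Q] [Module.Free R Q] [Module.Finite R Q] [AddCommGroup M] [Module R M]

lemma fg_ker_of_free (f : P →ₗ[R] Q) : (LinearMap.ker f).FG := by
  obtain ⟨l, h, hh⟩ := Module.Finite.exists_fin' R P
  let b := (Module.Free.chooseBasis R Q).reindex (Fintype.equivFin _)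
  have hk := (fg_ker_of_pi (b.equivFun.toLinearMap ∘ₗ f ∘ₗ h)).map h
  convert hk
  rw [LinearEquiv.ker_comp, LinearMap.ker_comp, Submodule.map_comap_eq_of_surjective hh]

lemma finitePresentation_of_injective (f : P →ₗ[R] Q) (hf : Function.Injective f) :
    Module.FinitePresentation R P := by
  obtain ⟨l, h, hh⟩ := Module.Finite.exists_fin' R P
  refine Module.finitePresentation_of_surjective h hh ?_
  have := fg_ker_of_free (f ∘ₗ h)
  rwa [LinearMap.ker_comp, LinearMap.ker_eq_bot.2 hf, Submodule.comap_bot] at this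

lemma finitePresentation_ker [Module.FinitePresentation R M] (f : Q →ₗ[R] M)
    (hf : Function.Surjective f) : Module.FinitePresentation R (LinearMap.ker f) := by
  have : Module.Finite R (LinearMap.ker f) := .of_fg (Module.FinitePresentation.fg_ker f hf)
  exact finitePresentation_of_injective (LinearMap.ker f).subtype (Submodule.subtype_injective _)

/-- Dualizing a finite presentation makes M^* the kernel of a map of finite free modules, hence a
finitely generated submodule of a free module. -/
lemma finitePresentation_dual [Module.FinitePresentation R M] :
    Module.FinitePresentation R (Module.Dual R M) := by
  obtain ⟨m, p, hp⟩ := Module.Finite.exists_fin' R M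
  have := finitePresentation_ker p hp
  obtain ⟨k, h, hh⟩ := Module.Finite.exists_fin' R (LinearMap.ker p)
  have hex : Function.Exact ((LinearMap.ker p).subtype ∘ₗ h) p := by
    rw [LinearMap.exact_iff, LinearMap.range_comp_of_range_eq_top _ (LinearMap.range_eq_top.2 hh),
      Submodule.range_subtype]
  have hfg := fg_ker_of_free ((LinearMap.ker p).subtype ∘ₗ h).dualMap
  rw [LinearMap.exact_iff.1 (exact_dualMap hex hp)] at hfg
  have : Module.Finite R (LinearMap.range p.dualMap) := .of_fg hfg
  have : Module.Finite R (Module.Dual R M) :=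
    .equiv (LinearEquiv.ofInjective _ (dualMap_injective hp)).symm
  exact finitePresentation_of_injective p.dualMap (dualMap_injective hp)

end Coherent

/-! ### Lifting and reducing maps along R → S, and division by x. -/

section Semilinear

variable {R S : Type u} [CommRing R] [CommRing S] (π : R →+* S)

/-- The coordinatewise semilinear map `Rⁿ → Sⁿ` induced by `R → S`. -/
def piMap (ι : Type*) : (ι → R) →ₛₗ[π] (ι → S) where
  toFun v i := π (v i)
  map_add' _ _ := funext fun _ => map_add π _ _
  map_smul' _ _ := funext fun _ => map_mul π _ _

variable {π}

@[simp]
lemma piMap_apply {ι : Type*} (v : ι → R) (i : ι) : piMap π ι v i = π (v i) := rfl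

lemma piMap_surjective [RingHomSurjective π] (ι : Type*) : Function.Surjective (piMap π ι) := by
  intro v
  choose w hw using fun i => RingHom.surjective π (v i)
  exact ⟨w, funext hw⟩

lemma exists_lift_pi {A N : Type*} [AddCommGroup A] [Module R A] [AddCommGroup N]
    [Module S N] (q : A →ₛₗ[π] N) (hq : Function.Surjective q) {m : ℕ}
    (σ : (Fin m → R) →ₛₗ[π] N) : ∃ h : (Fin m → R) →ₗ[R] A, ∀ w, q (h w) = σ w := by
  choose a ha using fun j => hq (σ (Pi.single j 1))
  refine ⟨Fintype.linearCombination R a, fun w => ?_⟩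
  conv_rhs => rw [pi_eq_sum_univ' w]
  simp [Fintype.linearCombination_apply, ha, map_sum, LinearMap.map_smulₛₗ]

lemma exists_lift_functional [RingHomSurjective π] {m : ℕ} (σ : (Fin m → R) →ₛₗ[π] S) :
    ∃ h : (Fin m → R) →ₗ[R] R, ∀ w, π (h w) = σ w :=
  exists_lift_pi π.toSemilinearMap (RingHom.surjective π) σ

lemma exists_descend_pi {N : Type*} [AddCommGroup N] [Module S N] {m : ℕ}
    (σ : (Fin m → R) →ₛₗ[π] N) : ∃ h : (Fin m → S) →ₗ[S] N, ∀ w, h (piMap π _ w) = σ w := by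
  refine ⟨Fintype.linearCombination S fun j => σ (Pi.single j 1), fun w => ?_⟩
  conv_rhs => rw [pi_eq_sum_univ' w]
  simp [Fintype.linearCombination_apply, map_sum, LinearMap.map_smulₛₗ]

variable {x : R}

lemma isCoherentRing_of_surjective [IsCoherentRing R] [RingHomSurjective π]
    (hx : ∀ r, π r = 0 ↔ x ∣ r) : IsCoherentRing S where
  finitePresentation_of_fg I hI := by
    have : Module.Finite S I := .of_fg hI
    obtain ⟨m, h, hh⟩ := Module.Finite.exists_fin' S I
    refine Module.finitePresentation_of_surjective h hh ?_
    obtain ⟨l, hl⟩ := exists_lift_functional ((I.subtype ∘ₗ h).comp (piMap π (Fin m)))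
    -- A relation over S lifts to w with l(w) divisible by x, that is, to a pair (w, r) with l(w) +
    -- rx = 0; these pairs form a finitely generated module over R.
    have hfg := fg_ker_of_free (l.coprod (LinearMap.toSpanSingleton R R x))
    suffices H : LinearMap.ker h = (LinearMap.ker (l.coprod (LinearMap.toSpanSingleton R R x))).map
        ((piMap π (Fin m)).comp (LinearMap.fst R (Fin m → R) R)) from H ▸ hfg.map _
    ext v
    obtain ⟨w, rfl⟩ := piMap_surjective (π := π) _ v
    simp only [Submodule.mem_map, LinearMap.mem_ker, LinearMap.comp_apply]
    constructor
    · intro hw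
      have : π (l w) = 0 := by rw [hl]; simp [hw]
      obtain ⟨r, hr⟩ := (hx _).1 this
      exact ⟨(w, -r), by simp [hr, mul_comm], rfl⟩
    · rintro ⟨⟨w', r⟩, h0, h1⟩
      have h1 : piMap π (Fin m) w' = piMap π _ w := h1
      rw [← h1]
      have : π (l w') = 0 := by
        rw [hx]
        exact ⟨-r, by simpa [mul_comm] using eq_neg_of_add_eq_zero_left h0⟩
      rw [hl] at this
      exact Subtype.ext this

/-- A linear map with values divisible by a non-zero-divisor can be divided by it. -/
lemma exists_smul_of_dvd (hxr : x ∈ nonZeroDivisors R) {M : Type*} [AddCommGroup M] [Module R M]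
    (φ : M →ₗ[R] R) (h : ∀ m, x ∣ φ m) : ∃ ψ : M →ₗ[R] R, ∀ m, φ m = x * ψ m := by
  choose ψ hψ using h
  have cancel : ∀ {a b : R}, x * a = x * b → a = b := fun {a b} hab =>
    (mul_cancel_left_mem_nonZeroDivisors hxr).1 hab
  exact ⟨{ toFun := ψ
           map_add' := fun a b => cancel (by rw [← hψ, map_add, mul_add, ← hψ, ← hψ])
           map_smul' := fun r a => cancel (by
            rw [← hψ, map_smul, RingHom.id_apply, smul_eq_mul, smul_eq_mul, hψ]; ring) }, hψ⟩

end Semilinear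

/-! ### From R to S: quotients by free submodules. -/

section Descent

variable {R S : Type u} [CommRing R] [CommRing S] {π : R →+* S} {x : R}

/-- The first syzygy over `R` of an `S`-module presented as a quotient of `Sᵐ`. -/
abbrev liftedSyzygy (π : R →+* S) {m : ℕ} {N : Type u} [AddCommGroup N] [Module S N]
    (h : (Fin m → S) →ₗ[S] N) : Submodule R (Fin m → R) :=
  (LinearMap.ker h).comap (piMap π (Fin m))

section

variable {m : ℕ} {N : Type u} [AddCommGroup N] [Module S N]

lemma smul_mem_liftedSyzygy (hπx : π x = 0) (h : (Fin m → S) →ₗ[S] N) (u : Fin m → R) :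
    x • u ∈ liftedSyzygy π h := by
  simp [liftedSyzygy, LinearMap.map_smulₛₗ, hπx]

/-- Multiplication by `x`, as a map from the free module to the lifted syzygy. -/
def smulToSyzygy (hπx : π x = 0) (h : (Fin m → S) →ₗ[S] N) :
    (Fin m → R) →ₗ[R] liftedSyzygy π h :=
  LinearMap.codRestrict _ (LinearMap.lsmul R _ x) (smul_mem_liftedSyzygy hπx h)

@[simp]
lemma coe_smulToSyzygy (hπx : π x = 0) (h : (Fin m → S) →ₗ[S] N) (u : Fin m → R) :
    (smulToSyzygy hπx h u : Fin m → R) = x • u := rfl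

lemma smulToSyzygy_coe (hπx : π x = 0) (h : (Fin m → S) →ₗ[S] N) (w : liftedSyzygy π h) :
    smulToSyzygy hπx h w = x • w := rfl

/-- Reduction modulo `x`, from the lifted syzygy to the syzygy over `S`. -/
def syzygyReduction (h : (Fin m → S) →ₗ[S] N) : liftedSyzygy π h →ₛₗ[π] LinearMap.ker h where
  toFun w := ⟨piMap π _ w, w.2⟩
  map_add' _ _ := Subtype.ext (map_add _ _ _)
  map_smul' _ _ := Subtype.ext (LinearMap.map_smulₛₗ _ _ _)

lemma piMap_eq_zero_iff (hx : ∀ r, π r = 0 ↔ x ∣ r) (w : Fin m → R) :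
    piMap π (Fin m) w = 0 ↔ ∃ u, w = x • u := by
  constructor
  · intro h
    choose u hu using fun i => (hx (w i)).1 (congrFun h i)
    exact ⟨u, funext hu⟩
  · rintro ⟨u, rfl⟩
    simp [LinearMap.map_smulₛₗ, (hx x).2 dvd_rfl]

lemma syzygyReduction_eq_zero_iff (hx : ∀ r, π r = 0 ↔ x ∣ r) (hπx : π x = 0)
    (h : (Fin m → S) →ₗ[S] N) (w : liftedSyzygy π h) :
    syzygyReduction h w = 0 ↔ ∃ u, smulToSyzygy hπx h u = w := by
  rw [← Submodule.coe_eq_zero]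
  refine (piMap_eq_zero_iff hx (w : Fin m → R)).trans (exists_congr fun u => ?_)
  rw [← Subtype.coe_inj, coe_smulToSyzygy, eq_comm]

lemma smulToSyzygy_injective (hxr : x ∈ nonZeroDivisors R) (hπx : π x = 0)
    (h : (Fin m → S) →ₗ[S] N) : Function.Injective (smulToSyzygy hπx h) := by
  intro u v huv
  have := congrArg Subtype.val huv
  ext i
  exact (mul_cancel_left_mem_nonZeroDivisors hxr).1 (congrFun this i)

end

/-- The `S`-module `N` is the quotient of a finitely presented `R`-module of G-dimension at
most `n` by a finite free submodule. -/
def HasLiftedGDimLE (π : R →+* S) (n : ℕ) (N : Type u) [AddCommGroup N] [Module S N] : Prop :=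
  ∃ (P A : ModuleCat.{u} R) (ι : P →ₗ[R] A) (q : A →ₛₗ[π] N),
    Module.Free R P ∧ Module.Finite R P ∧ Module.FinitePresentation R A ∧ HasGDimLE R n A ∧
      Function.Injective ι ∧ (∀ a, q a = 0 ↔ ∃ u, ι u = a) ∧ Function.Surjective q

variable {m n : ℕ} {N : Type u} [AddCommGroup N] [Module S N]

lemma HasLiftedGDimLE.finite (hN : HasLiftedGDimLE π n N) : Module.Finite S N := by
  obtain ⟨P, A, ι, q, _, _, _, hA, hι, hιq, hq⟩ := hN
  exact Module.Finite.of_surjective q hq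

variable [RingHomSurjective π]

lemma syzygyReduction_surjective (h : (Fin m → S) →ₗ[S] N) :
    Function.Surjective (syzygyReduction (π := π) h) := by
  rintro ⟨v, hv⟩
  obtain ⟨w, rfl⟩ := piMap_surjective (π := π) _ v
  exact ⟨⟨w, hv⟩, rfl⟩

/-- Semilinear functionals on a module lift when ordinary functionals on its first syzygy
extend. -/
lemma exists_lift_of_dualMap_surjective (hx : ∀ r, π r = 0 ↔ x ∣ r) (hxr : x ∈ nonZeroDivisors R)
    {A : Type u} [AddCommGroup A] [Module R A] {k : ℕ} (p : (Fin k → R) →ₗ[R] A)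
    (hp : Function.Surjective p) (hd : Function.Surjective (LinearMap.ker p).subtype.dualMap)
    (σ : A →ₛₗ[π] S) : ∃ ψ : A →ₗ[R] R, ∀ a, π (ψ a) = σ a := by
  obtain ⟨θ, hθ⟩ := exists_lift_functional (σ.comp p)
  -- On ker p the lift θ is x times a functional φ. Extending φ to η, the corrected lift θ - xη
  -- kills ker p and has the same reduction.
  obtain ⟨φ, hφ⟩ := exists_smul_of_dvd hxr (θ ∘ₗ (LinearMap.ker p).subtype) fun w => by
    rw [← hx, LinearMap.comp_apply, hθ, LinearMap.comp_apply, Submodule.subtype_apply,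
      LinearMap.mem_ker.1 w.2, map_zero]
  obtain ⟨η, rfl⟩ := hd φ
  obtain ⟨ψ, hψ⟩ := exists_factor_of_ker p hp (θ - x • η) fun w hw => by
    have := hφ ⟨w, hw⟩
    simpa [sub_eq_zero] using this
  refine ⟨ψ, fun a => ?_⟩
  obtain ⟨w, rfl⟩ := hp a
  have hπx : π x = 0 := (hx x).2 dvd_rfl
  rw [hψ, LinearMap.sub_apply, map_sub, hθ]
  simp [hπx]

lemma exists_lift_of_extVanishes (hx : ∀ r, π r = 0 ↔ x ∣ r) (hxr : x ∈ nonZeroDivisors R)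
    {A : Type u} [AddCommGroup A] [Module R A] [Module.Finite R A] (hA : ExtVanishes R A)
    (σ : A →ₛₗ[π] S) : ∃ ψ : A →ₗ[R] R, ∀ a, π (ψ a) = σ a := by
  obtain ⟨k, p, hp⟩ := Module.Finite.exists_fin' R A
  exact exists_lift_of_dualMap_surjective hx hxr p hp
    (hA.dualMap_surjective (Submodule.subtype_injective _) (exact_subtype_ker p) hp) σ

/-- Lift φ to ψ : Ω → R, using Ext^1_R(Ω,R) = 0. As φ vanishes on the image of xR^m, ψ(xu) = xθ(u)
for a functional θ on R^m. Cancelling x shows that θ extends ψ, so θ mod x extends φ. -/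
lemma dualMap_surjective_of_liftedSyzygy (hx : ∀ r, π r = 0 ↔ x ∣ r)
    (hxr : x ∈ nonZeroDivisors R) (h : (Fin m → S) →ₗ[S] N)
    (hG : IsGClass R (liftedSyzygy π h)) :
    Function.Surjective (LinearMap.ker h).subtype.dualMap := by
  intro φ
  have hπx : π x = 0 := (hx x).2 dvd_rfl
  have := hG.finite
  obtain ⟨ψ, hψ⟩ := exists_lift_of_extVanishes hx hxr hG.extVanishes
    (φ.comp (syzygyReduction (π := π) h))
  obtain ⟨θ, hθ⟩ := exists_smul_of_dvd hxr (ψ ∘ₗ smulToSyzygy hπx h) fun u => by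
    rw [← hx, LinearMap.comp_apply, hψ, LinearMap.comp_apply,
      (syzygyReduction_eq_zero_iff hx hπx h _).2 ⟨u, rfl⟩, map_zero]
  have hθ' : ∀ w : liftedSyzygy π h, θ w = ψ w := fun w =>
    (mul_cancel_left_mem_nonZeroDivisors hxr).1 (by
      rw [← hθ, LinearMap.comp_apply, smulToSyzygy_coe, map_smul, smul_eq_mul])
  obtain ⟨η, hη⟩ := exists_descend_pi (π.toSemilinearMap.comp θ)
  refine ⟨η, LinearMap.ext fun k => ?_⟩
  obtain ⟨w, rfl⟩ := syzygyReduction_surjective (π := π) h k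
  calc η (piMap π _ w) = π (θ w) := hη _
    _ = φ (syzygyReduction h w) := by rw [hθ', hψ]; rfl

variable [IsCoherentRing R]

/-- Lifting R^m → N to A gives a surjection P × R^m → A with P free. The second projection
identifies its kernel with Ω, so Ω is a first syzygy of A. For n = 0 the truncated `n - 1` is still
correct, as syzygies stay in the G-class. -/
lemma HasLiftedGDimLE.liftedSyzygy (hN : HasLiftedGDimLE π n N)
    (h : (Fin m → S) →ₗ[S] N) (hh : Function.Surjective h) :
    Module.FinitePresentation R (liftedSyzygy π h) ∧ HasGDimLE R (n - 1) (liftedSyzygy π h) := by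
  obtain ⟨P, A, ι, q, _, _, _, hA, hι, hιq, hq⟩ := hN
  obtain ⟨l, hl⟩ := exists_lift_pi q hq (h.comp (piMap π (Fin m)))
  have hl : ∀ w, q (l w) = h (piMap π _ w) := hl
  let Φ : P × (Fin m → R) →ₗ[R] A := ι.coprod l
  have hΦ : Function.Surjective Φ := by
    intro a
    obtain ⟨v, hv⟩ := hh (q a)
    obtain ⟨w, rfl⟩ := piMap_surjective (π := π) _ v
    obtain ⟨u, hu⟩ := (hιq (a - l w)).1 (by rw [map_sub, hl, hv, sub_self])
    exact ⟨(u, w), by simp [Φ, hu]⟩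
  let t : LinearMap.ker Φ →ₗ[R] (Fin m → R) := LinearMap.snd R P _ ∘ₗ (LinearMap.ker Φ).subtype
  have ht : Function.Injective t := by
    rw [injective_iff_map_eq_zero]
    rintro ⟨⟨u, w⟩, h0⟩ (rfl : w = 0)
    have : ι u = 0 := by simpa [Φ] using h0
    have : u = 0 := (injective_iff_map_eq_zero _).1 hι _ this
    subst this
    rfl
  have hrange : LinearMap.range t = _root_.liftedSyzygy π h := by
    ext w
    change (∃ y, t y = w) ↔ h (piMap π _ w) = 0
    rw [← hl, hιq]
    constructor
    · rintro ⟨⟨⟨u, w⟩, h0⟩, rfl⟩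
      have h0 : ι u + l w = 0 := h0
      exact ⟨-u, by rw [map_neg]; exact neg_eq_of_add_eq_zero_right h0⟩
    · rintro ⟨u, hu⟩
      exact ⟨⟨(-u, w), by simp [Φ, hu]⟩, rfl⟩
  let e : _root_.liftedSyzygy π h ≃ₗ[R] LinearMap.ker Φ :=
    (LinearEquiv.ofEq _ _ hrange.symm).trans (LinearEquiv.ofInjective t ht).symm
  have : Module.Finite R (LinearMap.ker Φ) := .of_fg (Module.FinitePresentation.fg_ker Φ hΦ)
  have := Module.Finite.equiv e.symm
  exact ⟨finitePresentation_of_injective (_root_.liftedSyzygy π h).subtype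
    (Submodule.subtype_injective _),
    (hA.of_free_cover (Submodule.subtype_injective _) (exact_subtype_ker Φ) hΦ).of_linearEquiv e⟩

lemma HasLiftedGDimLE.ker (hx : ∀ r, π r = 0 ↔ x ∣ r) (hxr : x ∈ nonZeroDivisors R)
    (hN : HasLiftedGDimLE π n N) (h : (Fin m → S) →ₗ[S] N) (hh : Function.Surjective h) :
    HasLiftedGDimLE π (n - 1) (LinearMap.ker h) := by
  obtain ⟨hG, hG'⟩ := hN.liftedSyzygy h hh
  have hπx : π x = 0 := (hx x).2 dvd_rfl
  exact ⟨ModuleCat.of R (Fin m → R), ModuleCat.of R (_root_.liftedSyzygy π h),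
    smulToSyzygy hπx h, syzygyReduction h, inferInstanceAs (Module.Free R (Fin m → R)),
    inferInstanceAs (Module.Finite R (Fin m → R)), hG, hG', smulToSyzygy_injective hxr hπx h,
    syzygyReduction_eq_zero_iff hx hπx h, syzygyReduction_surjective h⟩

/-- This is 0 → (R^m)^* → Ω^* → Ext^1_R(N,R) → 0 with the last term identified with Hom_S(N,S): ψ
goes to the functional induced by u ↦ ψ(xu) mod x. A preimage of ν is θ/x on Ω, where θ lifts ν to
R^m. -/
lemma hasLiftedGDimLE_dual (hx : ∀ r, π r = 0 ↔ x ∣ r)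
    (hxr : x ∈ nonZeroDivisors R) (h : (Fin m → S) →ₗ[S] N) (hh : Function.Surjective h)
    (hG : IsGClass R (liftedSyzygy π h)) [Module.FinitePresentation R (liftedSyzygy π h)] :
    HasLiftedGDimLE π 0 (Module.Dual S N) := by
  have hπx : π x = 0 := (hx x).2 dvd_rfl
  have cancel : ∀ {a b : R}, x * a = x * b → a = b := fun {a b} hab =>
    (mul_cancel_left_mem_nonZeroDivisors hxr).1 hab
  let ρ : (Fin m → R) →ₛₗ[π] N := h.comp (piMap π (Fin m))
  have hρ : Function.Surjective ρ := hh.comp (piMap_surjective _)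
  have uniq : ∀ {ν ν' : Module.Dual S N}, (∀ u, ν (ρ u) = ν' (ρ u)) → ν = ν' := by
    intro ν ν' hν
    ext y
    obtain ⟨u, rfl⟩ := hρ y
    exact hν u
  have ex : ∀ ψ : Module.Dual R (liftedSyzygy π h), ∃ ν : Module.Dual S N, ∀ u,
      ν (ρ u) = π (ψ (smulToSyzygy hπx h u)) := fun ψ =>
    exists_factor_of_ker ρ hρ (π.toSemilinearMap.comp (ψ ∘ₗ smulToSyzygy hπx h)) fun u hu => by
      change π (ψ (smulToSyzygy hπx h (⟨u, hu⟩ : liftedSyzygy π h))) = 0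
      rw [smulToSyzygy_coe, map_smul, smul_eq_mul, map_mul, hπx, zero_mul]
  choose Q hQ using ex
  let q : Module.Dual R (liftedSyzygy π h) →ₛₗ[π] Module.Dual S N :=
    { toFun := Q
      map_add' := fun a b => uniq fun u => by simp [hQ]
      map_smul' := fun r a => uniq fun u => by simp [hQ] }
  have hq : ∀ ψ u, q ψ (ρ u) = π (ψ (smulToSyzygy hπx h u)) := hQ
  have : Module.FinitePresentation R (Module.Dual R (liftedSyzygy π h)) := finitePresentation_dual
  refine ⟨ModuleCat.of R (Module.Dual R (Fin m → R)),
    ModuleCat.of R (Module.Dual R (liftedSyzygy π h)), (liftedSyzygy π h).subtype.dualMap, q,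
    inferInstanceAs (Module.Free R (Module.Dual R (Fin m → R))),
    inferInstanceAs (Module.Finite R (Module.Dual R (Fin m → R))), this, hG.dual, ?_, ?_, ?_⟩
  · rw [injective_iff_map_eq_zero]
    intro η hη
    refine LinearMap.ext fun u => cancel ?_
    have : η (x • u) = 0 := LinearMap.congr_fun hη (smulToSyzygy hπx h u)
    simpa using this
  · intro ψ
    constructor
    · intro h0
      obtain ⟨η, hη⟩ := exists_smul_of_dvd hxr (ψ ∘ₗ smulToSyzygy hπx h) fun u => by
        rw [← hx, LinearMap.comp_apply, ← hq, h0, LinearMap.zero_apply]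
      refine ⟨η, LinearMap.ext fun w => cancel ?_⟩
      have := hη w
      rw [LinearMap.comp_apply, smulToSyzygy_coe, map_smul, smul_eq_mul] at this
      exact this.symm
    · rintro ⟨η, rfl⟩
      refine uniq fun u => ?_
      rw [hq]
      simp [hπx]
  · intro ν
    obtain ⟨θ, hθ⟩ := exists_lift_functional (ν.comp ρ)
    obtain ⟨ψ, hψ⟩ := exists_smul_of_dvd hxr (θ ∘ₗ (liftedSyzygy π h).subtype) fun w => by
      rw [← hx, LinearMap.comp_apply, hθ, LinearMap.comp_apply]
      exact (congrArg ν w.2).trans (map_zero ν)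
    refine ⟨ψ, uniq fun u => ?_⟩
    have : ψ (smulToSyzygy hπx h u) = θ u := cancel (by
      rw [← hψ]; simp)
    rw [hq, this, hθ, LinearMap.comp_apply]

lemma HasLiftedGDimLE.isGClass (hx : ∀ r, π r = 0 ↔ x ∣ r) (hxr : x ∈ nonZeroDivisors R)
    (hN : HasLiftedGDimLE π 0 N) : IsGClass S N := by
  refine isGClass_of_syzygy_of_dual (fun M _ _ => HasLiftedGDimLE π 0 M) ?_ ?_ N hN
  · intro M _ _ hM
    have := hM.finite
    obtain ⟨m, h, hh⟩ := Module.Finite.exists_fin' S M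
    exact ⟨m, h, hh, dualMap_surjective_of_liftedSyzygy hx hxr h (hM.liftedSyzygy h hh).2,
      hM.ker hx hxr h hh⟩
  · intro M _ _ hM
    have := hM.finite
    obtain ⟨m, h, hh⟩ := Module.Finite.exists_fin' S M
    obtain ⟨hG, hG'⟩ := hM.liftedSyzygy h hh
    exact hasLiftedGDimLE_dual hx hxr h hh hG'

lemma HasLiftedGDimLE.hasGDimLE (hx : ∀ r, π r = 0 ↔ x ∣ r) (hxr : x ∈ nonZeroDivisors R)
    (hN : HasLiftedGDimLE π n N) : HasGDimLE S n N := by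
  induction n generalizing N with
  | zero => exact hN.isGClass hx hxr
  | succ n ih =>
    have := hN.finite
    obtain ⟨m, h, hh⟩ := Module.Finite.exists_fin' S N
    exact .of_exact (Submodule.subtype_injective _) (exact_subtype_ker h) hh (.of_free _)
      (ih (hN.ker hx hxr h hh))

/-- An ideal of `S` has finite G-dimension as soon as its preimage in `R` does. -/
lemma hasGDimLE_ideal_of_comap (hx : ∀ r, π r = 0 ↔ x ∣ r) (hxr : x ∈ nonZeroDivisors R)
    (I : Ideal S) (hfg : (I.comap π).FG) (h : HasGDimLE R n (I.comap π)) : HasGDimLE S n I := by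
  have hπx : π x = 0 := (hx x).2 dvd_rfl
  -- The witness is 0 → R → π⁻¹(I) → I → 0, whose first map is multiplication by x.
  refine HasLiftedGDimLE.hasGDimLE hx hxr ⟨ModuleCat.of R R, ModuleCat.of R (I.comap π),
    LinearMap.toSpanSingleton R _ ⟨x, by simp [Ideal.mem_comap, hπx]⟩,
    { toFun := fun a => ⟨π a, a.2⟩
      map_add' := fun a b => Subtype.ext (map_add π _ _)
      map_smul' := fun r a => Subtype.ext (map_mul π _ _) },
    inferInstanceAs (Module.Free R R), inferInstanceAs (Module.Finite R R),
    IsCoherentRing.finitePresentation_of_fg _ hfg, h, ?_, ?_, ?_⟩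
  · intro r r' hr
    exact (mul_cancel_right_mem_nonZeroDivisors hxr).1 (congrArg Subtype.val hr)
  · intro a
    rw [← Submodule.coe_eq_zero]
    refine (hx a).trans (exists_congr fun u => ?_)
    rw [← Subtype.coe_inj, eq_comm, mul_comm]
    rfl
  · rintro ⟨s, hs⟩
    obtain ⟨r, rfl⟩ := RingHom.surjective π s
    exact ⟨⟨r, hs⟩, rfl⟩

end Descent

/-! ### G-dimension of extensions and of submodules of free modules. -/

section Extension

variable {R : Type u} [CommRing R] [IsCoherentRing R]

/-- Horseshoe argument: free covers of A and C combine to one of B, and the kernels form a short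
exact sequence with smaller bounds. Coherence keeps the outer kernels finitely presented. -/
lemma HasGDimLE.middle {n : ℕ} {A B C : Type u} [AddCommGroup A] [Module R A]
    [AddCommGroup B] [Module R B] [AddCommGroup C] [Module R C]
    [Module.FinitePresentation R A] [Module.FinitePresentation R C]
    {f : A →ₗ[R] B} {g : B →ₗ[R] C} (hf : Function.Injective f) (hfg : Function.Exact f g)
    (hg : Function.Surjective g) (hA : HasGDimLE R n A) (hC : HasGDimLE R n C) :
    HasGDimLE R n B := by
  induction n generalizing A B C with
  | zero => exact IsGClass.middle hf hfg hg hA hC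
  | succ n ih =>
    obtain ⟨a, p, hp⟩ := Module.Finite.exists_fin' R A
    obtain ⟨c, r, hr⟩ := Module.Finite.exists_fin' R C
    obtain ⟨s, hs⟩ := Module.projective_lifting_property g r hg
    have hs' : ∀ u, g (s u) = r u := LinearMap.congr_fun hs
    have hgf := hfg.apply_apply_eq_zero
    have := finitePresentation_ker p hp
    have := finitePresentation_ker r hr
    have hKA := hA.of_free_cover (Submodule.subtype_injective _) (exact_subtype_ker p) hp
    have hKC := hC.of_free_cover (Submodule.subtype_injective _) (exact_subtype_ker r) hr
    let Φ : (Fin a → R) × (Fin c → R) →ₗ[R] B := (f ∘ₗ p).coprod s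
    have hΦ : Function.Surjective Φ := by
      intro b
      obtain ⟨u, hu⟩ := hr (g b)
      obtain ⟨y, hy⟩ := (hfg (b - s u)).1 (by rw [map_sub, hs', hu, sub_self])
      obtain ⟨v, rfl⟩ := hp y
      exact ⟨(v, u), by simp [Φ, hy]⟩
    let i : LinearMap.ker p →ₗ[R] LinearMap.ker Φ :=
      LinearMap.codRestrict _ (LinearMap.inl R _ _ ∘ₗ (LinearMap.ker p).subtype) fun v => by
        simp [Φ]
    let j : LinearMap.ker Φ →ₗ[R] LinearMap.ker r :=
      LinearMap.codRestrict _ (LinearMap.snd R _ _ ∘ₗ (LinearMap.ker Φ).subtype) fun w => by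
        have h0 : f (p w.1.1) + s w.1.2 = 0 := w.2
        simpa [hgf, hs'] using congrArg g h0
    have hi : Function.Injective i := fun v v' h =>
      Subtype.ext (congrArg (fun w : LinearMap.ker Φ => w.1.1) h)
    have hj : Function.Surjective j := by
      rintro ⟨u, hu⟩
      obtain ⟨y, hy⟩ := (hfg (s u)).1 (by rw [hs', hu])
      obtain ⟨v, rfl⟩ := hp y
      exact ⟨⟨(-v, u), by simp [Φ, hy]⟩, rfl⟩
    have hij : Function.Exact i j := by
      rintro ⟨⟨v, u⟩, hw⟩
      constructor
      · intro h0
        obtain rfl : u = 0 := congrArg Subtype.val h0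
        have h1 : f (p v) = 0 := by simpa [Φ] using hw
        exact ⟨⟨v, (injective_iff_map_eq_zero _).1 hf _ h1⟩, rfl⟩
      · rintro ⟨v', h⟩
        rw [← h]
        rfl
    exact .of_exact (Submodule.subtype_injective _) (exact_subtype_ker Φ) hΦ (.of_free _)
      (ih hi hij hj hKA hKC)

/-- If all finitely generated ideals have finite G-dimension, then so do all finitely generated
submodules of finite free modules. -/
lemma exists_hasGDimLE_of_injective (H : ∀ I : Ideal R, I.FG → ∃ n, HasGDimLE R n I) {n : ℕ}
    {N : Type u} [AddCommGroup N] [Module R N] [Module.Finite R N] (f : N →ₗ[R] (Fin n → R))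
    (hf : Function.Injective f) : ∃ d, HasGDimLE R d N := by
  induction n generalizing N with
  | zero =>
    have : Subsingleton N := hf.subsingleton
    exact ⟨0, IsGClass.of_free N⟩
  | succ n ih =>
    -- The first coordinate has an ideal as image, and its kernel embeds in a free module of smaller
    -- rank.
    let c : N →ₗ[R] R := LinearMap.proj 0 ∘ₗ f
    have hI : (LinearMap.range c).FG := Submodule.fg_range c
    have : Module.FinitePresentation R (LinearMap.range c) :=
      IsCoherentRing.finitePresentation_of_fg _ hI
    have hfg := Module.FinitePresentation.fg_ker c.rangeRestrict c.surjective_rangeRestrict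
    have : Module.Finite R (LinearMap.ker c.rangeRestrict) := .of_fg hfg
    have : Module.FinitePresentation R (LinearMap.ker c.rangeRestrict) :=
      finitePresentation_of_injective (f ∘ₗ (LinearMap.ker c.rangeRestrict).subtype)
        (hf.comp (Submodule.subtype_injective _))
    obtain ⟨d, hd⟩ := H _ hI
    obtain ⟨d', hd'⟩ := ih
      (LinearMap.funLeft R R Fin.succ ∘ₗ f ∘ₗ (LinearMap.ker c.rangeRestrict).subtype) (by
        rw [injective_iff_map_eq_zero]
        rintro ⟨w, hw⟩ h0
        have h1 : f w 0 = 0 := congrArg Subtype.val hw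
        refine Subtype.ext ((injective_iff_map_eq_zero _).1 hf _ (funext fun i => ?_))
        refine Fin.cases h1 (fun i => ?_) i
        exact congrFun h0 i)
    exact ⟨max d d', HasGDimLE.middle (Submodule.subtype_injective _)
      (exact_subtype_ker c.rangeRestrict) c.surjective_rangeRestrict
      (hd'.mono (le_max_right _ _)) (hd.mono (le_max_left _ _))⟩

end Extension

/-! ### From S to R: reduction modulo a regular element. -/

section Ascent

variable {R S : Type u} [CommRing R] [CommRing S] {π : R →+* S}

/-- `q` exhibits `N` as the quotient of `Ω` by the `Ω`-regular element `x`. -/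
structure IsRegularReduction (x : R) {Ω N : Type u} [AddCommGroup Ω] [Module R Ω]
    [AddCommGroup N] [Module S N] (q : Ω →ₛₗ[π] N) : Prop where
  surjective : Function.Surjective q
  eq_zero_iff : ∀ w, q w = 0 ↔ ∃ w', x • w' = w
  regular : ∀ w : Ω, x • w = 0 → w = 0

variable {x : R} {Ω N : Type u} [AddCommGroup Ω] [Module R Ω]
  [AddCommGroup N] [Module S N] {q : Ω →ₛₗ[π] N}

lemma IsRegularReduction.finite (hq : IsRegularReduction x q) [Module.Finite R Ω] :
    Module.Finite S N :=
  Module.Finite.of_surjective q hq.surjective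

variable [RingHomSurjective π]

/-- Regularity of x on Ω keeps 0 → ker p → R^m → Ω → 0 exact modulo x, so the reduction of a syzygy
is a syzygy of the reduction. -/
lemma IsRegularReduction.syzygy (hx : ∀ r, π r = 0 ↔ x ∣ r) (hxr : x ∈ nonZeroDivisors R)
    (hq : IsRegularReduction x q) {m : ℕ} (p : (Fin m → R) →ₗ[R] Ω) (hp : Function.Surjective p) :
    ∃ (p' : (Fin m → S) →ₗ[S] N) (q' : LinearMap.ker p →ₛₗ[π] LinearMap.ker p'),
      Function.Surjective p' ∧ IsRegularReduction x q' ∧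
        ∀ w, (q' w : Fin m → S) = piMap π _ w := by
  obtain ⟨p', hp'⟩ := exists_descend_pi (q.comp p)
  have hp' : ∀ w, p' (piMap π _ w) = q (p w) := hp'
  let q' : LinearMap.ker p →ₛₗ[π] LinearMap.ker p' :=
    { toFun := fun w => ⟨piMap π _ w, by rw [LinearMap.mem_ker, hp', w.2, map_zero]⟩
      map_add' := fun _ _ => Subtype.ext (map_add _ _ _)
      map_smul' := fun _ _ => Subtype.ext (LinearMap.map_smulₛₗ _ _ _) }
  have reg : ∀ w : Fin m → R, x • w = 0 → w = 0 := fun w hw =>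
    funext fun i => (mul_left_mem_nonZeroDivisors_eq_zero_iff hxr).1 (congrFun hw i)
  refine ⟨p', q', fun y => ?_, ⟨?_, fun w => ?_, fun w hw => ?_⟩, fun _ => rfl⟩
  · obtain ⟨a, rfl⟩ := hq.surjective y
    obtain ⟨w, rfl⟩ := hp a
    exact ⟨piMap π _ w, hp' w⟩
  · rintro ⟨v, hv⟩
    obtain ⟨w, rfl⟩ := piMap_surjective (π := π) _ v
    rw [LinearMap.mem_ker, hp', hq.eq_zero_iff] at hv
    obtain ⟨a, ha⟩ := hv
    obtain ⟨u, rfl⟩ := hp a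
    refine ⟨⟨w - x • u, by rw [LinearMap.mem_ker, map_sub, map_smul, ha, sub_self]⟩,
      Subtype.ext ?_⟩
    change piMap π _ (w - x • u) = piMap π _ w
    rw [map_sub, (piMap_eq_zero_iff hx _).2 ⟨u, rfl⟩, sub_zero]
  · rw [← Submodule.coe_eq_zero]
    refine (piMap_eq_zero_iff hx (w : Fin m → R)).trans ⟨?_, ?_⟩
    · rintro ⟨u, hu⟩
      refine ⟨⟨u, hq.regular _ ?_⟩, Subtype.ext hu.symm⟩
      rw [← map_smul, ← hu]
      exact w.2
    · rintro ⟨u, rfl⟩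
      exact ⟨u, rfl⟩
  · exact Subtype.ext (reg _ (congrArg Subtype.val hw))

/-- Functionals on a syzygy extend, by Nakayama's lemma, if they do so modulo `x`. -/
lemma dualMap_surjective_of_reduction (hx : ∀ r, π r = 0 ↔ x ∣ r)
    (hxr : x ∈ nonZeroDivisors R) (hxj : x ∈ Ideal.jacobson (⊥ : Ideal R)) {m : ℕ}
    (K : Submodule R (Fin m → R)) [Module.Finite R (Module.Dual R K)]
    (K' : Submodule S (Fin m → S)) (q : K →ₛₗ[π] K') (hq : IsRegularReduction x q)
    (hqK : ∀ w, (q w : Fin m → S) = piMap π _ w)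
    (hK' : Function.Surjective K'.subtype.dualMap) : Function.Surjective K.subtype.dualMap := by
  have hπx : π x = 0 := (hx x).2 dvd_rfl
  rw [← LinearMap.range_eq_top, ← top_le_iff]
  -- By Nakayama it suffices that each φ is a restriction plus x times a functional: extend φ mod x
  -- to S^m, lift the extension to R^m, and divide the difference by x.
  refine Submodule.le_of_le_smul_of_le_jacobson_bot (I := Ideal.span {x}) Module.Finite.fg_top
    ((Ideal.span_singleton_le_iff_mem _).2 hxj) ?_
  intro φ _
  obtain ⟨φ', hφ'⟩ := exists_factor_of_ker q hq.surjective (π.toSemilinearMap.comp φ) fun w hw => by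
    obtain ⟨w', rfl⟩ := (hq.eq_zero_iff w).1 hw
    simp [hπx]
  obtain ⟨η', rfl⟩ := hK' φ'
  obtain ⟨η, hη⟩ := exists_lift_functional (η'.comp (piMap π (Fin m)))
  obtain ⟨ψ, hψ⟩ := exists_smul_of_dvd hxr (φ - K.subtype.dualMap η) fun w => by
    have h1 : η' (q w : Fin m → S) = π (φ w) := hφ' w
    have h2 : π (η w) = η' (piMap π _ w) := hη w
    rw [← hx, LinearMap.sub_apply, map_sub, ← h1, hqK, ← h2]
    exact sub_self _
  have : φ = K.subtype.dualMap η + x • ψ := by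
    rw [← sub_eq_iff_eq_add']
    exact LinearMap.ext hψ
  rw [this]
  exact Submodule.add_mem_sup ⟨η, rfl⟩
    (Submodule.smul_mem_smul (Ideal.mem_span_singleton_self x) Submodule.mem_top)

/-- The kernel of Ω^* → N^* is xΩ^* by dividing by x. Surjectivity is the lifting of functionals
from S to R, which is where `hd` enters. -/
lemma IsRegularReduction.dual (hx : ∀ r, π r = 0 ↔ x ∣ r) (hxr : x ∈ nonZeroDivisors R)
    (hq : IsRegularReduction x q) {m : ℕ} (p : (Fin m → R) →ₗ[R] Ω) (hp : Function.Surjective p)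
    (hd : Function.Surjective (LinearMap.ker p).subtype.dualMap) :
    ∃ q' : Module.Dual R Ω →ₛₗ[π] Module.Dual S N, IsRegularReduction x q' := by
  have hπx : π x = 0 := (hx x).2 dvd_rfl
  have uniq : ∀ {ν ν' : Module.Dual S N}, (∀ w, ν (q w) = ν' (q w)) → ν = ν' := by
    intro ν ν' hν
    ext y
    obtain ⟨u, rfl⟩ := hq.surjective y
    exact hν u
  have ex : ∀ φ : Module.Dual R Ω, ∃ ν : Module.Dual S N, ∀ w, ν (q w) = π (φ w) := fun φ =>
    exists_factor_of_ker q hq.surjective (π.toSemilinearMap.comp φ) fun w hw => by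
      obtain ⟨w', rfl⟩ := (hq.eq_zero_iff w).1 hw
      simp [hπx]
  choose Q hQ using ex
  refine ⟨{ toFun := Q
            map_add' := fun a b => uniq fun u => by simp [hQ]
            map_smul' := fun r a => uniq fun u => by simp [hQ] }, fun ν => ?_, fun φ => ?_,
    fun φ h0 => LinearMap.ext fun w => ?_⟩
  · obtain ⟨φ, hφ⟩ := exists_lift_of_dualMap_surjective hx hxr p hp hd (ν.comp q)
    exact ⟨φ, uniq fun u => (hQ _ _).trans (hφ u)⟩
  · constructor
    · intro h0
      obtain ⟨ψ, hψ⟩ := exists_smul_of_dvd hxr φ fun w => by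
        rw [← hx, ← hQ]
        exact LinearMap.congr_fun h0 _
      exact ⟨ψ, LinearMap.ext fun w => (hψ w).symm⟩
    · rintro ⟨ψ, rfl⟩
      exact uniq fun u => (hQ _ _).trans (by simp [hπx])
  · exact (mul_left_mem_nonZeroDivisors_eq_zero_iff hxr).1 (LinearMap.congr_fun h0 w)

variable [IsCoherentRing R]

/-- The criterion is applied to all finitely presented R-modules having a regular reduction in the
G-class of S. -/
lemma IsRegularReduction.isGClass (hx : ∀ r, π r = 0 ↔ x ∣ r) (hxr : x ∈ nonZeroDivisors R)
    (hxj : x ∈ Ideal.jacobson (⊥ : Ideal R)) [Module.FinitePresentation R Ω]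
    (hq : IsRegularReduction x q) (hN : IsGClass S N) : IsGClass R Ω := by
  have syz : ∀ (Ω N : Type u) [AddCommGroup Ω] [Module R Ω] [AddCommGroup N] [Module S N]
      (q : Ω →ₛₗ[π] N), Module.FinitePresentation R Ω → IsRegularReduction x q → IsGClass S N →
      ∃ (m : ℕ) (p : (Fin m → R) →ₗ[R] Ω), Function.Surjective p ∧
        Function.Surjective (LinearMap.ker p).subtype.dualMap ∧
        Module.FinitePresentation R (LinearMap.ker p) ∧
        ∃ (N' : ModuleCat.{u} S) (q' : LinearMap.ker p →ₛₗ[π] N'),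
          IsRegularReduction x q' ∧ IsGClass S N' := by
    intro Ω N _ _ _ _ q _ hq hN
    obtain ⟨m, p, hp⟩ := Module.Finite.exists_fin' R Ω
    obtain ⟨p', q', hp', hq', hqp⟩ := hq.syzygy hx hxr p hp
    have hK := finitePresentation_ker p hp
    have : Module.FinitePresentation R (Module.Dual R (LinearMap.ker p)) := finitePresentation_dual
    have := hq'.finite
    refine ⟨m, p, hp, dualMap_surjective_of_reduction hx hxr hxj _ _ q' hq' hqp
      (hN.extVanishes.dualMap_surjective (Submodule.subtype_injective _) (exact_subtype_ker p')
        hp'), hK, ModuleCat.of S (LinearMap.ker p'), q', hq', ?_⟩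
    exact .left (Submodule.subtype_injective _) (exact_subtype_ker p') hp' (.of_free _) hN
  refine isGClass_of_syzygy_of_dual (fun Ω _ _ => Module.FinitePresentation R Ω ∧
    ∃ (N : ModuleCat.{u} S) (q : Ω →ₛₗ[π] N), IsRegularReduction x q ∧ IsGClass S N) ?_ ?_ Ω
    ⟨inferInstance, ModuleCat.of S N, q, hq, hN⟩
  · rintro Ω _ _ ⟨hΩ, N, q, hq, hN⟩
    exact syz Ω N q hΩ hq hN
  · rintro Ω _ _ ⟨hΩ, N, q, hq, hN⟩
    obtain ⟨m, p, hp, hd, -⟩ := syz Ω N q hΩ hq hN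
    obtain ⟨q', hq'⟩ := hq.dual hx hxr p hp hd
    have hfp : Module.FinitePresentation R (Module.Dual R Ω) := finitePresentation_dual
    have := hq'.finite
    exact ⟨hfp, ModuleCat.of S (Module.Dual S N), q', hq', hN.dual⟩

lemma IsRegularReduction.hasGDimLE (hx : ∀ r, π r = 0 ↔ x ∣ r) (hxr : x ∈ nonZeroDivisors R)
    (hxj : x ∈ Ideal.jacobson (⊥ : Ideal R)) [Module.FinitePresentation R Ω]
    (hq : IsRegularReduction x q) {n : ℕ} (hN : HasGDimLE S n N) : HasGDimLE R n Ω := by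
  induction n generalizing Ω N with
  | zero => exact hq.isGClass hx hxr hxj hN
  | succ n ih =>
    obtain ⟨m, p, hp⟩ := Module.Finite.exists_fin' R Ω
    obtain ⟨p', q', hp', hq', -⟩ := hq.syzygy hx hxr p hp
    have hK := finitePresentation_ker p hp
    have := hq'.finite
    exact .of_exact (Submodule.subtype_injective _) (exact_subtype_ker p) hp (.of_free _)
      (ih hq' (hN.of_free_cover (Submodule.subtype_injective _) (exact_subtype_ker p') hp'))

/-- If the finitely generated ideals of `S` have finite G-dimension, then so do those of `R`. -/
lemma exists_hasGDimLE_ideal (hx : ∀ r, π r = 0 ↔ x ∣ r) (hxr : x ∈ nonZeroDivisors R)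
    (hxj : x ∈ Ideal.jacobson (⊥ : Ideal R)) (H : ∀ I : Ideal S, I.FG → ∃ n, HasGDimLE S n I)
    (I : Ideal R) (hI : I.FG) : ∃ n, HasGDimLE R n I := by
  have := IsCoherentRing.finitePresentation_of_fg I hI
  have := isCoherentRing_of_surjective hx
  obtain ⟨m, p, hp⟩ := Module.Finite.exists_fin' R I
  have := finitePresentation_ker p hp
  -- Since x is regular on I, ker p ∩ xR^m = x ker p, so this image is the reduction of ker p.
  -- Passing to the syzygy is what yields a submodule of a free S-module; I/xI need not be one.
  let N : Submodule S (Fin m → S) := (LinearMap.ker p).map (piMap π (Fin m))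
  let q : LinearMap.ker p →ₛₗ[π] N :=
    { toFun := fun w => ⟨piMap π _ w, Submodule.mem_map_of_mem w.2⟩
      map_add' := fun _ _ => Subtype.ext (map_add _ _ _)
      map_smul' := fun _ _ => Subtype.ext (LinearMap.map_smulₛₗ _ _ _) }
  have reg : ∀ r : R, x * r = 0 → r = 0 := fun r =>
    (mul_left_mem_nonZeroDivisors_eq_zero_iff hxr).1
  have hq : IsRegularReduction x q := by
    refine ⟨?_, fun w => ?_, fun w hw => ?_⟩
    · rintro ⟨_, w, hw, rfl⟩
      exact ⟨⟨w, hw⟩, rfl⟩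
    · rw [← Submodule.coe_eq_zero]
      refine (piMap_eq_zero_iff hx (w : Fin m → R)).trans ⟨?_, ?_⟩
      · rintro ⟨u, hu⟩
        refine ⟨⟨u, Subtype.ext (reg _ ?_)⟩, Subtype.ext hu.symm⟩
        have h1 : x • p u = 0 := by rw [← map_smul, ← hu, w.2]
        exact congrArg Subtype.val h1
      · rintro ⟨u, rfl⟩
        exact ⟨u, rfl⟩
    · exact Subtype.ext (funext fun i => reg _ (congrFun (congrArg Subtype.val hw) i))
  have := hq.finite
  obtain ⟨d, hd⟩ := exists_hasGDimLE_of_injective H N.subtype (Submodule.subtype_injective _)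
  exact ⟨d + 1, .of_exact (Submodule.subtype_injective _) (exact_subtype_ker p) hp (.of_free _)
    (hq.hasGDimLE hx hxr hxj hd)⟩

end Ascent

/-! ### The theorem. -/

theorem theorem5p7 (R : Type u) [CommRing R] [IsLocalRing R] [IsCoherentRing R]
    (x : R) (hxm : x ∈ IsLocalRing.maximalIdeal R) (hx : x ∈ nonZeroDivisors R) :
    IsGorensteinQuasiLocal R ↔ IsGorensteinQuasiLocal (R ⧸ Ideal.span {x}) := by
  let π : R →+* R ⧸ Ideal.span {x} := Ideal.Quotient.mk _
  have hπ : ∀ r, π r = 0 ↔ x ∣ r := fun r => by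
    rw [Ideal.Quotient.eq_zero_iff_mem, Ideal.mem_span_singleton]
  have : RingHomSurjective π := ⟨Ideal.Quotient.mk_surjective⟩
  have hxj : x ∈ Ideal.jacobson (⊥ : Ideal R) := by
    rwa [IsLocalRing.jacobson_eq_maximalIdeal _ bot_ne_top]
  constructor
  · rintro ⟨-, H⟩
    have : Nontrivial (R ⧸ Ideal.span {x}) :=
      Ideal.Quotient.nontrivial_iff.2 fun h =>
        (IsLocalRing.mem_maximalIdeal x).1 hxm (Ideal.span_singleton_eq_top.1 h)
    refine ⟨IsLocalRing.of_surjective' π Ideal.Quotient.mk_surjective, fun I hI => ?_⟩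
    -- The preimage is an extension of I by the principal ideal (x), hence finitely generated.
    have hfg : (I.comap π).FG := by
      refine Ideal.fg_of_fg_map_of_fg_inf_ker_of_surjective (f := π) ?_ ?_
        Ideal.Quotient.mk_surjective
      · rwa [Ideal.map_comap_of_surjective π Ideal.Quotient.mk_surjective]
      · have hle : RingHom.ker π ≤ I.comap π := Ideal.comap_mono bot_le
        rw [inf_eq_right.2 hle, Ideal.mk_ker]
        exact Submodule.fg_span_singleton x
    obtain ⟨n, hn⟩ := (gDim_lt_top_iff _).1 (H _ hfg)
    exact (gDim_lt_top_iff _).2 ⟨n, hasGDimLE_ideal_of_comap hπ hx I hfg hn⟩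
  · rintro ⟨-, H⟩
    refine ⟨inferInstance, fun I hI => (gDim_lt_top_iff _).2 ?_⟩
    exact exists_hasGDimLE_ideal hπ hx hxj (fun J hJ => (gDim_lt_top_iff _).1 (H J hJ)) I hI
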